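/- Let $f:\mathbb{R}\to\mathbb{R}$, $m\in\mathbb{R}$, $\sigma\in\mathbb{R}$ and $x_0\in\mathbb{R}\setminus\{0\}$. Assume that $f$ is smooth at $x_0$, put $\gamma_k := \frac{f^{(k)}(x_0)}{k!}x_0^k$ for $k\ge 0$, and assume that the Taylor expansion $f(m)=\sum_{k=0}^\infty \gamma_k\left(\frac{m}{x_0}-1\right)^k$ holds, that (i) for some $c>0$, $|\gamma_k|\le c$ for all $k\ge 0$; (ii) $g^k=o(|\gamma_k|)$ as $k\to\infty$ for every $g\in(0,1)$; (iii) $\beta_0:=|m/x_0-1|<1$; and that $\beta^2:=\frac{\sigma^2}{x_0^2}+\left(\frac{m}{x_0}-1\right)^2<1$. For each $p\in(0,1-\beta^2)$, let $X_1,X_2,\dots$ be independent and identically distributed real random variables with mean $m$ and variance $\sigma^2$, and let $R$ be independent of $(X_i)_{i\ge1}$ with $\mathbb{P}(R=k)=(1-p)^k p$ for $k=0,1,2,\dots$ (the probability space and these random variables may depend on $p$). Put $U^{\mathrm C}_{r,0}:=1$ for $r\ge 0$ and, for $1\le k\le r$, $$U^{\mathrm C}_{r,k}:=\frac1r\sum_{j=1}^{r}\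 \prod_{i=j}^{j+k-1}\left(\frac{X_{[i]_r}}{x_0}-1\right),$$ where $[i]_r\in\{1,\dots,r\}$ is congruent to $i$ modulo $r$ (the average over the $r$ circular shifts of $X_1,\dots,X_r$). Let the cycling estimator be $$\hat f^{\mathrm C}:=\sum_{k=0}^{R}\frac{\gamma_k\,U^{\mathrm C}_{R,k}}{\mathbb{P}(R\ge k)}.$$ Then $\hat f^{\mathrm C}$ converges to $f(m)$ in probability as $p\to0$: for every $\varepsilon>0$, $\mathbb{P}\left(|\hat f^{\mathrm C}-f(m)|\ge\varepsilon\right)\to0$ as $p\downarrow 0$. -/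

import Mathlib

open MeasureTheory ProbabilityTheory Filter Topology Asymptotics

noncomputable section

/-- The normalised Taylor coefficient `γ_k = f^(k)(x₀) / k! * x₀^k`. -/
def taylorGamma (f : ℝ → ℝ) (x₀ : ℝ) (k : ℕ) : ℝ :=
  iteratedDeriv k f x₀ / (k.factorial : ℝ) * x₀ ^ k

/-- `β² = σ² / x₀² + (m / x₀ - 1)²`. -/
def betaSq (m σ x₀ : ℝ) : ℝ :=
  σ ^ 2 / x₀ ^ 2 + (m / x₀ - 1) ^ 2

/-- The cycling coefficient estimate `U_{r,k}` computed from a data sequence `x`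
(the entry `x i` is the `(i+1)`-st observation): the average, over the `r` circular shifts of
the first `r` observations, of the product of the first `k` factors `x_i / x₀ - 1`.
By convention `U_{r,0} = 1`, also for `r = 0`. -/
def cyclingU (x₀ : ℝ) (x : ℕ → ℝ) (r k : ℕ) : ℝ :=
  if k = 0 then 1
  else (∑ j ∈ Finset.range r, ∏ i ∈ Finset.range k, (x ((j + i) % r) / x₀ - 1)) / (r : ℝ)

/-- The cycling sum estimator `∑_{k=0}^R γ_k U_{R,k} / ℙ(R ≥ k)`. -/
def cyclingEstimator {Ω : Type*} [MeasurableSpace Ω] (P : Measure Ω) (f : ℝ → ℝ) (x₀ : ℝ)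
    (X : ℕ → Ω → ℝ) (R : Ω → ℕ) (ω : Ω) : ℝ :=
  ∑ k ∈ Finset.range (R ω + 1),
    taylorGamma f x₀ k * cyclingU x₀ (fun i => X i ω) (R ω) k / P.real {ω' | k ≤ R ω'}

/-- `X 0, X 1, …` are independent and identically distributed real random variables on the
probability space `(Ω, P)`, square integrable, with mean `m` and variance `σ²`. -/
structure IsIIDSample {Ω : Type*} [MeasurableSpace Ω] (P : Measure Ω) (X : ℕ → Ω → ℝ)
    (m σ : ℝ) : Prop where
  measurable : ∀ i, Measurable (X i)
  indep : iIndepFun X P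
  identDistrib : ∀ i, IdentDistrib (X i) (X 0) P P
  memLp : MemLp (X 0) 2 P
  mean : ∫ ω, X 0 ω ∂P = m
  variance : variance (X 0) P = σ ^ 2

end

/-! Write b = m/x₀ - 1 and β = √(`betaSq`). Since P(R ≥ k) = (1-p)^k, the estimator is a
fluctuation, the sum over k ≤ R of γ_k (U_{R,k} - b^k)/(1-p)^k, plus the deterministic sum of γ_k
b^k/(1-p)^k (`cyclingEstimator_eq`).

Fluctuation: products over disjoint windows are uncorrelated, and a window of length k meets at most
k² of the r windows, so U_{r,k} has mean squared error at most k² β^(2k)/r. Once β/(1-p) ≤ ρ < 1,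
the fluctuation at R = r has L¹ norm at most c Σ k ρ^k / √r.

Bias: as |b| ≤ β, replacing (1-p)^k by 1 costs at most p c Σ k ρ^k, by Bernoulli's inequality. What
is left is a Taylor partial sum, close to f(m) when R is large.

Independence of R lets Markov's inequality be applied for each r ≥ N, while P(R < N) ≤ Np. Choosing
N first and then p small finishes the proof. -/

/-! ### Moments of products of independent variables. -/

/-- The product over a finite index set of independent integrable variables with common mean `a`
is integrable, with mean `a ^ #S`. -/
theorem integral_prod_of_iIndepFun {Ω : Type*} [MeasurableSpace Ω] {P : Measure Ω}
    [IsProbabilityMeasure P] {Y : ℕ → Ω → ℝ} {a : ℝ} (hmeas : ∀ i, Measurable (Y i))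
    (hind : iIndepFun Y P) (hint : ∀ i, Integrable (Y i) P) (hmean : ∀ i, ∫ ω, Y i ω ∂P = a)
    (S : Finset ℕ) :
    Integrable (fun ω => ∏ i ∈ S, Y i ω) P ∧ ∫ ω, ∏ i ∈ S, Y i ω ∂P = a ^ S.card := by
  induction S using Finset.induction_on with
  | empty => simp
  | insert s S hs ih =>
    have hI : IndepFun (fun ω => ∏ i ∈ S, Y i ω) (Y s) P := by
      have := hind.indepFun_finsetProd_of_notMem hmeas hs
      convert this using 1
      ext ω
      simp
    have h1 := hI.symm.integrable_mul (hint s) ih.1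
    have h2 := hI.symm.integral_mul_eq_mul_integral (hint s).1 ih.1.1
    simp only [Finset.prod_insert hs, Finset.card_insert_of_notMem hs]
    refine ⟨h1, h2.trans ?_⟩
    rw [hmean, ih.2, pow_succ']

section Products

variable {Ω : Type*} [MeasurableSpace Ω] {P : Measure Ω} [IsProbabilityMeasure P]
  {Y : ℕ → Ω → ℝ} {b B : ℝ}

theorem memLp_two_prod_of_iIndepFun (hmeas : ∀ i, Measurable (Y i)) (hind : iIndepFun Y P)
    (hsq : ∀ i, Integrable (fun ω => Y i ω ^ 2) P) (hB : ∀ i, ∫ ω, Y i ω ^ 2 ∂P = B)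
    (S : Finset ℕ) :
    MemLp (fun ω => ∏ i ∈ S, Y i ω) 2 P ∧ ∫ ω, (∏ i ∈ S, Y i ω) ^ 2 ∂P = B ^ S.card := by
  have h := integral_prod_of_iIndepFun (Y := fun i ω => Y i ω ^ 2)
    (fun i => (hmeas i).pow_const 2)
    (hind.comp (fun _ x => x ^ 2) (fun _ => measurable_id.pow_const 2)) hsq hB S
  simp only [Finset.prod_pow] at h
  refine ⟨(memLp_two_iff_integrable_sq ?_).2 h.1, h.2⟩
  exact (Finset.measurable_fun_prod S fun i _ => hmeas i).aestronglyMeasurable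

/-- A variance is at most the second moment, which factors by independence. -/
theorem integral_prod_sub_sq_le (hmeas : ∀ i, Measurable (Y i)) (hind : iIndepFun Y P)
    (hint : ∀ i, Integrable (Y i) P) (hb : ∀ i, ∫ ω, Y i ω ∂P = b)
    (hsq : ∀ i, Integrable (fun ω => Y i ω ^ 2) P) (hB : ∀ i, ∫ ω, Y i ω ^ 2 ∂P = B)
    (S : Finset ℕ) :
    ∫ ω, (∏ i ∈ S, Y i ω - b ^ S.card) ^ 2 ∂P ≤ B ^ S.card := by
  obtain ⟨h1, h2⟩ := integral_prod_of_iIndepFun hmeas hind hint hb S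
  obtain ⟨h3, h4⟩ := memLp_two_prod_of_iIndepFun hmeas hind hsq hB S
  have e : ∀ ω, (∏ i ∈ S, Y i ω - b ^ S.card) ^ 2 = (∏ i ∈ S, Y i ω) ^ 2
      - (2 * b ^ S.card * ∏ i ∈ S, Y i ω) + (b ^ S.card) ^ 2 := fun ω => by ring
  have h5 : Integrable (fun ω => (∏ i ∈ S, Y i ω) ^ 2 - 2 * b ^ S.card * ∏ i ∈ S, Y i ω) P :=
    h3.integrable_sq.sub (h1.const_mul _)
  simp_rw [e]
  rw [integral_add h5 (integrable_const _), integral_sub h3.integrable_sq (h1.const_mul _), h4, integral_const_mul, h2]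
  simp only [integral_const, probReal_univ, smul_eq_mul]
  nlinarith [sq_nonneg (b ^ S.card)]

theorem memLp_two_prod_sub (hmeas : ∀ i, Measurable (Y i)) (hind : iIndepFun Y P)
    (hsq : ∀ i, Integrable (fun ω => Y i ω ^ 2) P) (hB : ∀ i, ∫ ω, Y i ω ^ 2 ∂P = B)
    (S : Finset ℕ) (a : ℝ) :
    MemLp (fun ω => ∏ i ∈ S, Y i ω - a) 2 P :=
  (memLp_two_prod_of_iIndepFun hmeas hind hsq hB S).1.sub (memLp_const a)

/-- From uv ≤ u²/2 + v²/2 and the variance bound, however S and T overlap. -/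
theorem integral_prod_sub_mul_prod_sub_le (hmeas : ∀ i, Measurable (Y i)) (hind : iIndepFun Y P)
    (hint : ∀ i, Integrable (Y i) P) (hb : ∀ i, ∫ ω, Y i ω ∂P = b)
    (hsq : ∀ i, Integrable (fun ω => Y i ω ^ 2) P) (hB : ∀ i, ∫ ω, Y i ω ^ 2 ∂P = B)
    {k : ℕ} {S T : Finset ℕ} (hS : S.card = k) (hT : T.card = k) :
    ∫ ω, (∏ i ∈ S, Y i ω - b ^ k) * (∏ i ∈ T, Y i ω - b ^ k) ∂P ≤ B ^ k := by
  have hS2 := integral_prod_sub_sq_le hmeas hind hint hb hsq hB S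
  have hT2 := integral_prod_sub_sq_le hmeas hind hint hb hsq hB T
  have mS := memLp_two_prod_sub hmeas hind hsq hB S (b ^ k)
  have mT := memLp_two_prod_sub hmeas hind hsq hB T (b ^ k)
  rw [hS] at hS2
  rw [hT] at hT2
  have : ∫ ω, (∏ i ∈ S, Y i ω - b ^ k) * (∏ i ∈ T, Y i ω - b ^ k) ∂P
      ≤ ∫ ω, ((∏ i ∈ S, Y i ω - b ^ k) ^ 2 / 2 + (∏ i ∈ T, Y i ω - b ^ k) ^ 2 / 2) ∂P := by
    refine integral_mono (mS.integrable_mul mT)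
      ((mS.integrable_sq.div_const 2).add (mT.integrable_sq.div_const 2)) fun ω => ?_
    dsimp only
    nlinarith [sq_nonneg ((∏ i ∈ S, Y i ω - b ^ k) - (∏ i ∈ T, Y i ω - b ^ k))]
  rw [integral_add (mS.integrable_sq.div_const 2) (mT.integrable_sq.div_const 2),
    integral_div, integral_div] at this
  linarith

theorem integral_prod_sub_mul_prod_sub_eq_zero (hmeas : ∀ i, Measurable (Y i))
    (hind : iIndepFun Y P) (hint : ∀ i, Integrable (Y i) P) (hb : ∀ i, ∫ ω, Y i ω ∂P = b)
    {k : ℕ} {S T : Finset ℕ} (hS : S.card = k) (hT : T.card = k) (hST : Disjoint S T) :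
    ∫ ω, (∏ i ∈ S, Y i ω - b ^ k) * (∏ i ∈ T, Y i ω - b ^ k) ∂P = 0 := by
  obtain ⟨hS1, hS2⟩ := integral_prod_of_iIndepFun hmeas hind hint hb S
  obtain ⟨hT1, hT2⟩ := integral_prod_of_iIndepFun hmeas hind hint hb T
  obtain ⟨hU1, hU2⟩ := integral_prod_of_iIndepFun hmeas hind hint hb (S ∪ T)
  rw [Finset.card_union_of_disjoint hST] at hU2
  have e : ∀ ω, (∏ i ∈ S, Y i ω - b ^ k) * (∏ i ∈ T, Y i ω - b ^ k) =
      ∏ i ∈ S ∪ T, Y i ω - b ^ k * ∏ i ∈ S, Y i ω - b ^ k * ∏ i ∈ T, Y i ω + b ^ k * b ^ k := by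
    intro ω
    rw [Finset.prod_union hST]
    ring
  have h1 : Integrable (fun ω => ∏ i ∈ S ∪ T, Y i ω - b ^ k * ∏ i ∈ S, Y i ω) P :=
    hU1.sub (hS1.const_mul _)
  have h2 : Integrable
      (fun ω => ∏ i ∈ S ∪ T, Y i ω - b ^ k * ∏ i ∈ S, Y i ω - b ^ k * ∏ i ∈ T, Y i ω) P :=
    h1.sub (hT1.const_mul _)
  simp_rw [e]
  rw [integral_add h2 (integrable_const _), integral_sub h1 (hT1.const_mul _),
    integral_sub hU1 (hS1.const_mul _), integral_const_mul, integral_const_mul, hU2, hS2, hT2,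
    hS, hT]
  simp only [integral_const, probReal_univ, smul_eq_mul]
  ring

end Products

/-! ### Combinatorics of cyclic windows. -/

/-- The `k` consecutive indices modulo `r` that start at `j`. -/
def cyclicWindow (r k j : ℕ) : Finset ℕ :=
  (Finset.range k).image fun i => (j + i) % r

theorem add_mod_injOn_range {r k : ℕ} (hk : k ≤ r) (j : ℕ) :
    Set.InjOn (fun i => (j + i) % r) (Finset.range k : Set ℕ) := by
  intro a ha b hb hab
  simp only [Finset.coe_range, Set.mem_Iio] at ha hb
  have h : a ≡ b [MOD r] := Nat.ModEq.add_left_cancel' j hab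
  exact Nat.ModEq.eq_of_lt_of_lt h (ha.trans_le hk) (hb.trans_le hk)

theorem card_cyclicWindow {r k : ℕ} (hk : k ≤ r) (j : ℕ) : (cyclicWindow r k j).card = k := by
  rw [cyclicWindow, Finset.card_image_of_injOn (add_mod_injOn_range hk j), Finset.card_range]

/-- A common index sits at position a in window j and a' in window l; the pair (a, a') determines l
modulo r. -/
theorem card_cyclicWindow_meeting_le (r k j : ℕ) :
    ((Finset.range r).filter fun l => ¬ Disjoint (cyclicWindow r k j) (cyclicWindow r k l)).card
      ≤ k ^ 2 := by
  have h : ∀ l ∈ (Finset.range r).filter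
      (fun l => ¬ Disjoint (cyclicWindow r k j) (cyclicWindow r k l)),
      ∃ q ∈ Finset.range k ×ˢ Finset.range k, (j + q.1) % r = (l + q.2) % r := by
    intro l hl
    obtain ⟨x, hx, hx'⟩ := Finset.not_disjoint_iff.1 (Finset.mem_filter.1 hl).2
    obtain ⟨a, ha, rfl⟩ := Finset.mem_image.1 hx
    obtain ⟨a', ha', h⟩ := Finset.mem_image.1 hx'
    exact ⟨(a, a'), Finset.mem_product.2 ⟨ha, ha'⟩, h.symm⟩
  choose! q hq hq' using h
  calc _ ≤ (Finset.range k ×ˢ Finset.range k).card := by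
        refine Finset.card_le_card_of_injOn q hq fun l hl l' hl' e => ?_
        have h1 := hq' l hl
        have h2 := hq' l' hl'
        rw [← e] at h2
        have h3 : l ≡ l' [MOD r] := Nat.ModEq.add_right_cancel' (q l).2 (h1.symm.trans h2)
        exact Nat.ModEq.eq_of_lt_of_lt h3 (Finset.mem_range.1 (Finset.mem_filter.1 hl).1)
          (Finset.mem_range.1 (Finset.mem_filter.1 hl').1)
    _ = k ^ 2 := by simp [sq]

theorem cyclingU_eq_sum_prod_cyclicWindow (x₀ : ℝ) (x : ℕ → ℝ) {r k : ℕ} (hr : 0 < r)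
    (hk : k ≤ r) :
    cyclingU x₀ x r k =
      (∑ j ∈ Finset.range r, ∏ i ∈ cyclicWindow r k j, (x i / x₀ - 1)) / (r : ℝ) := by
  rw [cyclingU]
  split_ifs with h
  · subst h
    -- The average of r empty products is 1 only because r > 0.
    have : (r : ℝ) ≠ 0 := by positivity
    simp [cyclicWindow, this]
  · congr 1
    refine Finset.sum_congr rfl fun j _ => ?_
    rw [cyclicWindow, Finset.prod_image (add_mod_injOn_range hk j)]

theorem measurable_cyclingU (x₀ : ℝ) (r k : ℕ) : Measurable fun x => cyclingU x₀ x r k := by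
  unfold cyclingU
  split_ifs <;> fun_prop

/-! ### Error of the cycling estimates of powers. -/

theorem IsIIDSample.integral_eq {Ω : Type*} [MeasurableSpace Ω] {P : Measure Ω}
    {X : ℕ → Ω → ℝ} {m σ : ℝ} (hX : IsIIDSample P X m σ) (i : ℕ) : ∫ ω, X i ω ∂P = m :=
  (hX.identDistrib i).integral_eq.trans hX.mean

theorem IsIIDSample.iIndepFun_factor {Ω : Type*} [MeasurableSpace Ω] {P : Measure Ω}
    {X : ℕ → Ω → ℝ} {m σ : ℝ} (hX : IsIIDSample P X m σ) (x₀ : ℝ) :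
    iIndepFun (fun i ω => X i ω / x₀ - 1) P :=
  hX.indep.comp (fun _ x => x / x₀ - 1) fun _ => by fun_prop

theorem IsIIDSample.measurable_factor {Ω : Type*} [MeasurableSpace Ω] {P : Measure Ω}
    {X : ℕ → Ω → ℝ} {m σ : ℝ} (hX : IsIIDSample P X m σ) (x₀ : ℝ) (i : ℕ) :
    Measurable fun ω => X i ω / x₀ - 1 :=
  ((hX.measurable i).div_const x₀).sub_const 1

section Moments

variable {Ω : Type*} [MeasurableSpace Ω] {P : Measure Ω} [IsProbabilityMeasure P]
  {X : ℕ → Ω → ℝ} {m σ : ℝ}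

theorem IsIIDSample.memLp_factor (hX : IsIIDSample P X m σ) (x₀ : ℝ) (i : ℕ) :
    MemLp (fun ω => X i ω / x₀ - 1) 2 P := by
  have h : MemLp (X i) 2 P := (hX.identDistrib i).memLp_iff.2 hX.memLp
  simp_rw [div_eq_mul_inv]
  exact (h.mul_const x₀⁻¹).sub (memLp_const 1)

theorem IsIIDSample.integral_factor (hX : IsIIDSample P X m σ) (x₀ : ℝ) (i : ℕ) :
    ∫ ω, (X i ω / x₀ - 1) ∂P = m / x₀ - 1 := by
  have h : Integrable (X i) P :=
    ((hX.identDistrib i).memLp_iff.2 hX.memLp).integrable one_le_two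
  rw [integral_sub (h.div_const _) (integrable_const _), integral_div, hX.integral_eq]
  simp

theorem IsIIDSample.integral_factor_sq (hX : IsIIDSample P X m σ) (x₀ : ℝ) (i : ℕ) :
    ∫ ω, (X i ω / x₀ - 1) ^ 2 ∂P = betaSq m σ x₀ := by
  have hL := (hX.identDistrib i).memLp_iff.2 hX.memLp
  have hv : ∫ ω, (X i ω - m) ^ 2 ∂P = σ ^ 2 := by
    rw [← hX.variance, ← (hX.identDistrib i).variance_eq,
      variance_eq_integral (hX.measurable i).aemeasurable, hX.integral_eq]
  have hm : ∫ ω, (X i ω - m) ∂P = 0 := by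
    rw [integral_sub (hL.integrable one_le_two) (integrable_const _), hX.integral_eq]
    simp
  have hL' : MemLp (fun ω => X i ω - m) 2 P := hL.sub (memLp_const m)
  have e : ∀ ω, (X i ω / x₀ - 1) ^ 2 = (X i ω - m) ^ 2 / x₀ ^ 2
      + 2 * (m / x₀ - 1) / x₀ * (X i ω - m) + (m / x₀ - 1) ^ 2 := fun ω => by ring
  simp_rw [e]
  have h1 : Integrable
      (fun ω => (X i ω - m) ^ 2 / x₀ ^ 2 + 2 * (m / x₀ - 1) / x₀ * (X i ω - m)) P :=
    (hL'.integrable_sq.div_const _).add ((hL'.integrable one_le_two).const_mul _)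
  rw [integral_add h1 (integrable_const _),
    integral_add (hL'.integrable_sq.div_const _) ((hL'.integrable one_le_two).const_mul _),
    integral_div, integral_const_mul, hv, hm, betaSq]
  simp

theorem betaSq_nonneg (m σ x₀ : ℝ) : 0 ≤ betaSq m σ x₀ := by
  unfold betaSq
  positivity

theorem IsIIDSample.memLp_cyclingU_sub (hX : IsIIDSample P X m σ) (x₀ a : ℝ) {r k : ℕ}
    (hr : 0 < r) (hk : k ≤ r) :
    MemLp (fun ω => cyclingU x₀ (fun i => X i ω) r k - a) 2 P := by
  have h : MemLp (fun ω => ∑ j ∈ Finset.range r,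
      ∏ i ∈ cyclicWindow r k j, (X i ω / x₀ - 1)) 2 P :=
    memLp_finsetSum _ fun j _ => (memLp_two_prod_of_iIndepFun (hX.measurable_factor x₀)
      (hX.iIndepFun_factor x₀) (fun i => (hX.memLp_factor x₀ i).integrable_sq)
      (hX.integral_factor_sq x₀) _).1
  have h' := (h.mul_const (r : ℝ)⁻¹).sub (memLp_const a)
  refine h'.congr_norm ?_ (Eventually.of_forall fun ω => ?_)
  · exact (((measurable_cyclingU x₀ r k).comp (measurable_pi_lambda _ hX.measurable)).sub_const
      a).aestronglyMeasurable
  · simp [cyclingU_eq_sum_prod_cyclicWindow x₀ _ hr hk, div_eq_mul_inv]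

/-- The mean squared error of the cycling estimate of `(m / x₀ - 1) ^ k`. -/
theorem IsIIDSample.integral_cyclingU_sub_sq_le (hX : IsIIDSample P X m σ) (x₀ : ℝ) {r k : ℕ}
    (hr : 0 < r) (hk : k ≤ r) :
    ∫ ω, (cyclingU x₀ (fun i => X i ω) r k - (m / x₀ - 1) ^ k) ^ 2 ∂P
      ≤ k ^ 2 * betaSq m σ x₀ ^ k / r := by
  set b := m / x₀ - 1 with hb
  set B := betaSq m σ x₀ with hB
  have hB0 : 0 ≤ B := betaSq_nonneg m σ x₀
  have hr' : (0 : ℝ) < r := by exact_mod_cast hr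
  set D : ℕ → Ω → ℝ := fun j ω => ∏ i ∈ cyclicWindow r k j, (X i ω / x₀ - 1) - b ^ k with hD
  have hDL : ∀ j, MemLp (D j) 2 P := fun j =>
    memLp_two_prod_sub (hX.measurable_factor x₀) (hX.iIndepFun_factor x₀)
      (fun i => (hX.memLp_factor x₀ i).integrable_sq) (hX.integral_factor_sq x₀) _ _
  have e : ∀ ω, (cyclingU x₀ (fun i => X i ω) r k - b ^ k) ^ 2
      = (∑ j ∈ Finset.range r, ∑ l ∈ Finset.range r, D j ω * D l ω) / (r : ℝ) ^ 2 := by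
    intro ω
    rw [← Finset.sum_mul_sum, cyclingU_eq_sum_prod_cyclicWindow x₀ _ hr hk]
    simp only [hD, Finset.sum_sub_distrib, Finset.sum_const, Finset.card_range, nsmul_eq_mul]
    field_simp
  have hDD : ∀ j l, Integrable (fun ω => D j ω * D l ω) P := fun j l =>
    (hDL j).integrable_mul (hDL l)
  simp_rw [e]
  rw [integral_div, integral_finsetSum _ fun j _ => integrable_finsetSum _ fun l _ => hDD j l]
  -- In the double sum of covariances, row j keeps only the windows meeting window j.
  have hrow : ∀ j ∈ Finset.range r,
      ∫ ω, ∑ l ∈ Finset.range r, D j ω * D l ω ∂P ≤ k ^ 2 * B ^ k := by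
    intro j _
    rw [integral_finsetSum _ fun l _ => hDD j l]
    calc ∑ l ∈ Finset.range r, ∫ ω, D j ω * D l ω ∂P
        ≤ ∑ l ∈ Finset.range r,
          if ¬ Disjoint (cyclicWindow r k j) (cyclicWindow r k l) then B ^ k else 0 := by
          refine Finset.sum_le_sum fun l _ => ?_
          split_ifs with hd
          · exact (integral_prod_sub_mul_prod_sub_eq_zero (hX.measurable_factor x₀)
              (hX.iIndepFun_factor x₀) (fun i => (hX.memLp_factor x₀ i).integrable one_le_two)
              (hX.integral_factor x₀) (card_cyclicWindow hk j) (card_cyclicWindow hk l)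
              hd).le
          · exact integral_prod_sub_mul_prod_sub_le (hX.measurable_factor x₀)
              (hX.iIndepFun_factor x₀) (fun i => (hX.memLp_factor x₀ i).integrable one_le_two)
              (hX.integral_factor x₀) (fun i => (hX.memLp_factor x₀ i).integrable_sq)
              (hX.integral_factor_sq x₀) (card_cyclicWindow hk j) (card_cyclicWindow hk l)
      _ = (((Finset.range r).filter fun l =>
            ¬ Disjoint (cyclicWindow r k j) (cyclicWindow r k l)).card : ℝ) * B ^ k := by
          rw [← Finset.sum_filter, Finset.sum_const, nsmul_eq_mul]
      _ ≤ k ^ 2 * B ^ k := by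
          refine mul_le_mul_of_nonneg_right ?_ (by positivity)
          exact_mod_cast card_cyclicWindow_meeting_le r k j
  calc _ ≤ (∑ _j ∈ Finset.range r, (k : ℝ) ^ 2 * B ^ k) / (r : ℝ) ^ 2 := by
        gcongr with j hj
        exact hrow j hj
    _ = k ^ 2 * B ^ k / r := by
        simp only [Finset.sum_const, Finset.card_range, nsmul_eq_mul]
        field_simp

/-- Nonnegativity of the variance of |Z|. -/
theorem integral_abs_le_sqrt_integral_sq {Z : Ω → ℝ} (hZ : MemLp Z 2 P) :
    ∫ ω, |Z ω| ∂P ≤ √(∫ ω, Z ω ^ 2 ∂P) := by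
  refine Real.le_sqrt_of_sq_le ?_
  have h := variance_nonneg (fun ω => |Z ω|) P
  rw [variance_eq_sub (by exact hZ.abs)] at h
  simpa using h

theorem IsIIDSample.integral_abs_cyclingU_sub_le (hX : IsIIDSample P X m σ) (x₀ : ℝ) {r k : ℕ}
    (hr : 0 < r) (hk : k ≤ r) :
    ∫ ω, |cyclingU x₀ (fun i => X i ω) r k - (m / x₀ - 1) ^ k| ∂P
      ≤ k * √(betaSq m σ x₀) ^ k / √r := by
  refine (integral_abs_le_sqrt_integral_sq (hX.memLp_cyclingU_sub x₀ _ hr hk)).trans ?_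
  refine (Real.sqrt_le_sqrt (hX.integral_cyclingU_sub_sq_le x₀ hr hk)).trans_eq ?_
  have h := betaSq_nonneg m σ x₀
  have h' : √(betaSq m σ x₀ ^ k) = √(betaSq m σ x₀) ^ k := by
    rw [Real.sqrt_eq_iff_mul_self_eq (by positivity) (by positivity), ← mul_pow,
      Real.mul_self_sqrt h]
  rw [Real.sqrt_div' _ (Nat.cast_nonneg r), Real.sqrt_mul (by positivity),
    Real.sqrt_sq (Nat.cast_nonneg k), h']

end Moments

/-! ### Geometric tail, fluctuation and bias. -/

theorem measureReal_le_geometric {Ω : Type*} [MeasurableSpace Ω] {P : Measure Ω}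
    [IsProbabilityMeasure P] {R : Ω → ℕ} (hR : Measurable R) {p : ℝ}
    (hgeom : ∀ k : ℕ, P.real {ω | R ω = k} = (1 - p) ^ k * p) (k : ℕ) :
    P.real {ω | k ≤ R ω} = (1 - p) ^ k := by
  induction k with
  | zero => simp
  | succ k ih =>
    have h : {ω | k ≤ R ω} = {ω | R ω = k} ∪ {ω | k + 1 ≤ R ω} := by
      ext ω
      simp only [Set.mem_ofPred_eq, Set.mem_union]
      omega
    have hd : Disjoint {ω | R ω = k} {ω | k + 1 ≤ R ω} := by
      rw [Set.disjoint_left]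
      intro ω h1 h2
      simp only [Set.mem_ofPred_eq] at h1 h2
      omega
    rw [h, measureReal_union hd (measurableSet_le measurable_const hR), hgeom] at ih
    rw [pow_succ]
    linarith

/-- The weighted error of the cycling estimates of the powers of `m / x₀ - 1`, computed from `r`
observations. -/
noncomputable def cyclingFluctuation (γ : ℕ → ℝ) (x₀ b q : ℝ) (x : ℕ → ℝ) (r : ℕ) : ℝ :=
  ∑ k ∈ Finset.range (r + 1), γ k * (cyclingU x₀ x r k - b ^ k) / q ^ k

theorem measurable_cyclingFluctuation (γ : ℕ → ℝ) (x₀ b q : ℝ) (r : ℕ) :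
    Measurable fun x => cyclingFluctuation γ x₀ b q x r :=
  Finset.measurable_fun_sum _ fun k _ =>
    (((measurable_cyclingU x₀ r k).sub_const _).const_mul _).div_const _

theorem summable_natCast_mul_pow {ρ : ℝ} (h0 : 0 ≤ ρ) (h1 : ρ < 1) :
    Summable fun k : ℕ => (k : ℝ) * ρ ^ k := by
  simpa using summable_pow_mul_geometric_of_norm_lt_one 1
    (show ‖ρ‖ < 1 by rwa [Real.norm_of_nonneg h0])

/-- Gives a bound uniform in n and in a ≤ ρ, hence in small p when a = β/(1-p) or |b|/(1-p). -/
theorem sum_natCast_mul_pow_le {a ρ : ℝ} (ha : 0 ≤ a) (haρ : a ≤ ρ) (h1 : ρ < 1) (n : ℕ) :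
    ∑ k ∈ Finset.range n, (k : ℝ) * a ^ k ≤ ∑' k : ℕ, (k : ℝ) * ρ ^ k := by
  have h0 := ha.trans haρ
  calc ∑ k ∈ Finset.range n, (k : ℝ) * a ^ k ≤ ∑ k ∈ Finset.range n, (k : ℝ) * ρ ^ k := by gcongr
    _ ≤ _ := (summable_natCast_mul_pow h0 h1).sum_le_tsum _ fun k _ => by positivity

theorem integral_abs_cyclingFluctuation_le {Ω : Type*} [MeasurableSpace Ω] {P : Measure Ω}
    [IsProbabilityMeasure P] {X : ℕ → Ω → ℝ} {m σ x₀ q c ρ : ℝ} {γ : ℕ → ℝ}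
    (hX : IsIIDSample P X m σ) (hq : 0 < q) (hγ : ∀ k, |γ k| ≤ c)
    (hρ : √(betaSq m σ x₀) / q ≤ ρ) (hρ1 : ρ < 1) {r : ℕ} (hr : 0 < r) :
    Integrable (fun ω => cyclingFluctuation γ x₀ (m / x₀ - 1) q (fun i => X i ω) r) P ∧
    ∫ ω, |cyclingFluctuation γ x₀ (m / x₀ - 1) q (fun i => X i ω) r| ∂P
      ≤ c * (∑' k : ℕ, (k : ℝ) * ρ ^ k) / √r := by
  have hc : 0 ≤ c := (abs_nonneg _).trans (hγ 0)
  set b := m / x₀ - 1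
  have hI : ∀ k ∈ Finset.range (r + 1),
      Integrable (fun ω => cyclingU x₀ (fun i => X i ω) r k - b ^ k) P := fun k hk =>
    (hX.memLp_cyclingU_sub x₀ _ hr (Nat.lt_succ_iff.1 (Finset.mem_range.1 hk))).integrable
      one_le_two
  have hI' : ∀ k ∈ Finset.range (r + 1), Integrable
      (fun ω => |γ k * (cyclingU x₀ (fun i => X i ω) r k - b ^ k) / q ^ k|) P := fun k hk =>
    (((hI k hk).const_mul _).div_const _).abs
  have hZ : Integrable (fun ω => cyclingFluctuation γ x₀ b q (fun i => X i ω) r) P :=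
    integrable_finsetSum _ fun k hk => ((hI k hk).const_mul _).div_const _
  refine ⟨hZ, ?_⟩
  calc ∫ ω, |cyclingFluctuation γ x₀ b q (fun i => X i ω) r| ∂P
      ≤ ∫ ω, ∑ k ∈ Finset.range (r + 1),
          |γ k * (cyclingU x₀ (fun i => X i ω) r k - b ^ k) / q ^ k| ∂P :=
        integral_mono hZ.abs (integrable_finsetSum _ hI') fun ω => Finset.abs_sum_le_sum_abs _ _
    _ = ∑ k ∈ Finset.range (r + 1),
          ∫ ω, |γ k * (cyclingU x₀ (fun i => X i ω) r k - b ^ k) / q ^ k| ∂P :=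
        integral_finsetSum _ hI'
    _ ≤ ∑ k ∈ Finset.range (r + 1), c / √r * (k * (√(betaSq m σ x₀) / q) ^ k) := by
        refine Finset.sum_le_sum fun k hk => ?_
        have h := hX.integral_abs_cyclingU_sub_le x₀ hr
          (Nat.lt_succ_iff.1 (Finset.mem_range.1 hk))
        simp_rw [abs_div, abs_mul]
        rw [integral_div, integral_const_mul, abs_of_pos (pow_pos hq k)]
        calc _ ≤ c * (k * √(betaSq m σ x₀) ^ k / √r) / q ^ k := by
              gcongr
              exact hγ k
          _ = _ := by
              rw [div_pow]
              ring
    _ ≤ c / √r * ∑' k : ℕ, (k : ℝ) * ρ ^ k := by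
        rw [← Finset.mul_sum]
        gcongr
        exact sum_natCast_mul_pow_le (by positivity) hρ hρ1 _
    _ = _ := by ring

theorem abs_sum_div_pow_sub_sum_le {γ : ℕ → ℝ} {b c p ρ : ℝ} (hγ : ∀ k, |γ k| ≤ c)
    (hp0 : 0 < p) (hp1 : p < 1) (hρ : |b| / (1 - p) ≤ ρ) (hρ1 : ρ < 1) (n : ℕ) :
    |∑ k ∈ Finset.range n, γ k * b ^ k / (1 - p) ^ k - ∑ k ∈ Finset.range n, γ k * b ^ k|
      ≤ p * (c * ∑' k : ℕ, (k : ℝ) * ρ ^ k) := by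
  have hq : 0 < 1 - p := by linarith
  have hc : 0 ≤ c := (abs_nonneg _).trans (hγ 0)
  rw [← Finset.sum_sub_distrib]
  calc _ ≤ ∑ k ∈ Finset.range n, |γ k * b ^ k / (1 - p) ^ k - γ k * b ^ k| :=
        Finset.abs_sum_le_sum_abs _ _
    _ ≤ ∑ k ∈ Finset.range n, p * c * (k * (|b| / (1 - p)) ^ k) := by
        refine Finset.sum_le_sum fun k _ => ?_
        have hqk : 0 < (1 - p) ^ k := pow_pos hq k
        have h1 : (1 - p) ^ k ≤ 1 := pow_le_one₀ hq.le (by linarith)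
        -- Bernoulli's inequality; this supplies the factor p.
        have h2 : 1 - (1 - p) ^ k ≤ k * p := by
          have := one_add_mul_le_pow (a := -p) (by linarith) k
          rw [← sub_eq_add_neg 1 p] at this
          linarith
        have e : γ k * b ^ k / (1 - p) ^ k - γ k * b ^ k
            = γ k * (b ^ k / (1 - p) ^ k) * (1 - (1 - p) ^ k) := by field_simp
        rw [e, abs_mul, abs_mul, abs_div, abs_pow, abs_of_pos hqk,
          abs_of_nonneg (sub_nonneg.2 h1), ← div_pow]
        calc _ ≤ c * (|b| / (1 - p)) ^ k * (k * p) := by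
              gcongr
              exact hγ k
          _ = _ := by ring
    _ ≤ p * c * ∑' k : ℕ, (k : ℝ) * ρ ^ k := by
        rw [← Finset.mul_sum]
        gcongr
        exact sum_natCast_mul_pow_le (by positivity) hρ hρ1 _
    _ = _ := by ring

/-! ### Conditioning on R and conclusion. -/

/-- A countable mixture of events, each independent of the value of `R` and of probability at most
`η` once `R` is at least `N`. -/
theorem measure_le_add_of_indep {Ω : Type*} [MeasurableSpace Ω] {P : Measure Ω}
    [IsProbabilityMeasure P] {R : Ω → ℕ} (hR : Measurable R) {A : Set Ω} {E : ℕ → Set Ω}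
    {N : ℕ} {η : ENNReal} (hA : ∀ ω ∈ A, N ≤ R ω → ω ∈ E (R ω))
    (hind : ∀ r, N ≤ r → P ({ω | R ω = r} ∩ E r) = P {ω | R ω = r} * P (E r))
    (hE : ∀ r, N ≤ r → P (E r) ≤ η) :
    P A ≤ P {ω | R ω < N} + η := by
  have hsub : A ⊆ {ω | R ω < N} ∪ ⋃ r : ℕ, {ω | N ≤ r ∧ R ω = r} ∩ E r := by
    intro ω hω
    rcases lt_or_ge (R ω) N with h | h
    · exact Or.inl h
    · exact Or.inr (Set.mem_iUnion.2 ⟨R ω, ⟨h, rfl⟩, hA ω hω h⟩)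
  refine (measure_mono hsub).trans ((measure_union_le _ _).trans (add_le_add le_rfl ?_))
  calc P (⋃ r : ℕ, {ω | N ≤ r ∧ R ω = r} ∩ E r)
      ≤ ∑' r : ℕ, P ({ω | N ≤ r ∧ R ω = r} ∩ E r) := measure_iUnion_le _
    _ ≤ ∑' r : ℕ, P {ω | R ω = r} * η := by
        refine ENNReal.tsum_le_tsum fun r => ?_
        by_cases h : N ≤ r
        · simp only [h, true_and]
          rw [hind r h]
          gcongr
          exact hE r h
        · simp [h]
    _ ≤ 1 * η := by
        rw [ENNReal.tsum_mul_right]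
        gcongr
        -- The events R = r are disjoint, so their probabilities sum to at most 1.
        rw [← measure_univ (μ := P)]
        refine tsum_measure_le_measure_univ
          (fun r => (hR (measurableSet_singleton r)).nullMeasurableSet) fun r s hrs => ?_
        refine Disjoint.aedisjoint (Set.disjoint_left.2 fun ω h1 h2 => hrs ?_)
        exact h1.symm.trans h2
    _ = η := one_mul η

theorem cyclingEstimator_eq {Ω : Type*} [MeasurableSpace Ω] {P : Measure Ω}
    [IsProbabilityMeasure P] (f : ℝ → ℝ) (x₀ b : ℝ) (X : ℕ → Ω → ℝ) {R : Ω → ℕ}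
    (hR : Measurable R) {p : ℝ} (hgeom : ∀ k : ℕ, P.real {ω | R ω = k} = (1 - p) ^ k * p)
    (ω : Ω) :
    cyclingEstimator P f x₀ X R ω =
      cyclingFluctuation (taylorGamma f x₀) x₀ b (1 - p) (fun i => X i ω) (R ω) +
        ∑ k ∈ Finset.range (R ω + 1), taylorGamma f x₀ k * b ^ k / (1 - p) ^ k := by
  rw [cyclingEstimator, cyclingFluctuation, ← Finset.sum_add_distrib]
  refine Finset.sum_congr rfl fun k _ => ?_
  rw [measureReal_le_geometric hR hgeom k]
  ring

/-- A quantitative form of the consistency of the cycling estimator. -/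
theorem measure_cyclingEstimator_error_le {Ω : Type*} [MeasurableSpace Ω] {P : Measure Ω}
    [IsProbabilityMeasure P] {f : ℝ → ℝ} {m σ x₀ c p ρ ε s : ℝ} {X : ℕ → Ω → ℝ} {R : Ω → ℕ}
    (hX : IsIIDSample P X m σ) (hR : Measurable R)
    (hgeom : ∀ k : ℕ, P.real {ω | R ω = k} = (1 - p) ^ k * p)
    (hind : IndepFun R (fun ω i => X i ω) P) (hγ : ∀ k, |taylorGamma f x₀ k| ≤ c)
    (hp0 : 0 < p) (hp1 : p < 1) (hρ : √(betaSq m σ x₀) / (1 - p) ≤ ρ) (hρ1 : ρ < 1)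
    (hε : 0 < ε) (hpε : p * (c * ∑' k : ℕ, (k : ℝ) * ρ ^ k) ≤ ε) {N : ℕ} (hN : 0 < N)
    (hs : ∀ n, N ≤ n →
      |∑ k ∈ Finset.range n, taylorGamma f x₀ k * (m / x₀ - 1) ^ k - s| ≤ ε) :
    P {ω | 3 * ε ≤ |cyclingEstimator P f x₀ X R ω - s|}
      ≤ ENNReal.ofReal (N * p + c * (∑' k : ℕ, (k : ℝ) * ρ ^ k) / ε / √N) := by
  have hq : 0 < 1 - p := by linarith
  have hc : 0 ≤ c := (abs_nonneg _).trans (hγ 0)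
  have hρ0 : 0 ≤ ρ := le_trans (by positivity) hρ
  have hT : 0 ≤ ∑' k : ℕ, (k : ℝ) * ρ ^ k := tsum_nonneg fun k => by positivity
  set T := ∑' k : ℕ, (k : ℝ) * ρ ^ k
  set b := m / x₀ - 1 with hb
  have hbρ : |b| / (1 - p) ≤ ρ := by
    refine le_trans ?_ hρ
    gcongr
    refine Real.le_sqrt_of_sq_le ?_
    rw [sq_abs, betaSq]
    have : 0 ≤ σ ^ 2 / x₀ ^ 2 := by positivity
    linarith
  set Z : ℕ → (ℕ → ℝ) → ℝ := fun r x => cyclingFluctuation (taylorGamma f x₀) x₀ b (1 - p) x r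
  have hZm : ∀ r, MeasurableSet {x | ε ≤ |Z r x|} := fun r =>
    measurableSet_le measurable_const (measurable_cyclingFluctuation _ _ _ _ r).abs
  have key := measure_le_add_of_indep (P := P) hR
    (A := {ω | 3 * ε ≤ |cyclingEstimator P f x₀ X R ω - s|})
    (E := fun r => {ω | ε ≤ |Z r (fun i => X i ω)|}) (N := N)
    (η := ENNReal.ofReal (c * T / ε / √N)) ?_ ?_ ?_
  · refine key.trans ?_
    rw [ENNReal.ofReal_add (by positivity) (by positivity)]
    gcongr
    rw [← ofReal_measureReal]
    refine ENNReal.ofReal_le_ofReal ?_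
    have h1 : {ω | R ω < N} = {ω | N ≤ R ω}ᶜ := by
      ext ω
      simp
    rw [h1, probReal_compl_eq_one_sub (measurableSet_le measurable_const hR),
      measureReal_le_geometric hR hgeom]
    have := one_add_mul_le_pow (a := -p) (by linarith) N
    rw [← sub_eq_add_neg 1 p] at this
    linarith
  · intro ω hω hNR
    simp only [Set.mem_ofPred_eq] at hω ⊢
    rw [cyclingEstimator_eq f x₀ b X hR hgeom] at hω
    -- Bias and Taylor remainder are each at most ε, so an error of 3ε forces a fluctuation of at
    -- least ε.
    have h1 := abs_sum_div_pow_sub_sum_le hγ hp0 hp1 hbρ hρ1 (R ω + 1)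
    have h2 := hs (R ω + 1) (by omega)
    change 3 * ε ≤ |Z (R ω) (fun i => X i ω) + _ - s| at hω
    set S₁ := ∑ k ∈ Finset.range (R ω + 1), taylorGamma f x₀ k * b ^ k / (1 - p) ^ k
    set S₂ := ∑ k ∈ Finset.range (R ω + 1), taylorGamma f x₀ k * b ^ k
    have h3 : |Z (R ω) (fun i => X i ω) + S₁ - s|
        ≤ |Z (R ω) (fun i => X i ω)| + |S₁ - S₂| + |S₂ - s| := by
      have := abs_add_three (Z (R ω) (fun i => X i ω)) (S₁ - S₂) (S₂ - s)
      rwa [show Z (R ω) (fun i => X i ω) + (S₁ - S₂) + (S₂ - s)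
        = Z (R ω) (fun i => X i ω) + S₁ - s by ring] at this
    linarith
  · intro r _
    exact hind.measure_inter_preimage_eq_mul {r} {x | ε ≤ |Z r x|} (measurableSet_singleton r)
      (hZm r)
  · intro r hr
    have hr0 : 0 < r := hN.trans_le hr
    obtain ⟨h1, h2⟩ := integral_abs_cyclingFluctuation_le hX hq hγ hρ hρ1 hr0
    -- Markov's inequality.
    have h3 := mul_meas_ge_le_integral_of_nonneg (Eventually.of_forall fun ω => abs_nonneg _)
      h1.abs ε
    rw [← ofReal_measureReal]
    refine ENNReal.ofReal_le_ofReal ?_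
    have h4 : c * T / √r ≤ c * T / √N := by gcongr
    rw [div_right_comm, le_div_iff₀ hε, mul_comm]
    exact h3.trans (h2.trans h4)

theorem corollary1
    (f : ℝ → ℝ) (m σ x₀ c : ℝ) (hx₀ : x₀ ≠ 0)
    -- `f` is smooth at `x₀` and its Taylor series around `x₀` represents it at `m`
    (hf : ContDiffAt ℝ ((⊤ : ℕ∞) : WithTop ℕ∞) f x₀)
    (hTaylor : HasSum (fun k : ℕ => taylorGamma f x₀ k * (m / x₀ - 1) ^ k) (f m))
    -- the coefficients are bounded and do not decay geometrically
    (hc : 0 < c) (hbdd : ∀ k : ℕ, |taylorGamma f x₀ k| ≤ c)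
    (hdecay : ∀ g ∈ Set.Ioo (0 : ℝ) 1,
      (fun k : ℕ => g ^ k) =o[atTop] (fun k : ℕ => |taylorGamma f x₀ k|))
    -- `β₀ < 1` and `β < 1`
    (hβ₀ : |m / x₀ - 1| < 1) (hβ : betaSq m σ x₀ < 1)
    -- for every `p` in `(0, 1 - β²)`: an i.i.d. sample with mean `m` and variance `σ²`, and an
    -- independent `R ∼ Geometric(p)`, on a probability space that may depend on `p`
    {Ω : ℝ → Type*} [∀ p, MeasurableSpace (Ω p)]
    (P : ∀ p, Measure (Ω p)) [∀ p, IsProbabilityMeasure (P p)]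
    (X : ∀ p, ℕ → Ω p → ℝ) (R : ∀ p, Ω p → ℕ)
    (hX : ∀ p ∈ Set.Ioo 0 (1 - betaSq m σ x₀), IsIIDSample (P p) (X p) m σ)
    (hRmeas : ∀ p ∈ Set.Ioo 0 (1 - betaSq m σ x₀), Measurable (R p))
    (hRgeom : ∀ p ∈ Set.Ioo 0 (1 - betaSq m σ x₀), ∀ k : ℕ,
      (P p).real {ω | R p ω = k} = (1 - p) ^ k * p)
    (hindep : ∀ p ∈ Set.Ioo 0 (1 - betaSq m σ x₀),
      IndepFun (R p) (fun ω i => X p i ω) (P p)) :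
    -- convergence in probability to `f m` as `p ↓ 0`
    ∀ ε : ℝ, 0 < ε →
      Tendsto
        (fun p : ℝ => P p {ω | ε ≤ |cyclingEstimator (P p) f x₀ (X p) (R p) ω - f m|})
        (𝓝[>] 0) (𝓝 0) := by
  intro ε hε
  have hB0 := betaSq_nonneg m σ x₀
  have hβ0 : 0 ≤ √(betaSq m σ x₀) := Real.sqrt_nonneg _
  have hβ1 : √(betaSq m σ x₀) < 1 := by
    rw [Real.sqrt_lt' one_pos]
    simpa using hβ
  -- Midpoint of β and 1: the strict gap above β absorbs the factor 1/(1-p) for small p.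
  set ρ := (1 + √(betaSq m σ x₀)) / 2 with hρdef
  have hρ1 : ρ < 1 := by rw [hρdef]; linarith
  have hβρ : √(betaSq m σ x₀) < ρ := by rw [hρdef]; linarith
  set C := c * ∑' k : ℕ, (k : ℝ) * ρ ^ k with hC
  rw [ENNReal.tendsto_nhds_zero]
  intro η hη
  obtain ⟨δ, hδ0, hδη⟩ : ∃ δ : ℝ, 0 < δ ∧ ENNReal.ofReal δ ≤ η := by
    obtain ⟨δ, hδ0, hδη⟩ := ENNReal.lt_iff_exists_nnreal_btwn.1 hη
    exact ⟨δ, by exact_mod_cast hδ0, by simpa using hδη.le⟩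
  have hsum := hTaylor.tendsto_sum_nat
  have h1 : ∀ᶠ n : ℕ in atTop,
      |∑ k ∈ Finset.range n, taylorGamma f x₀ k * (m / x₀ - 1) ^ k - f m| ≤ ε / 3 :=
    (Metric.tendsto_nhds.1 hsum (ε / 3) (by positivity)).mono fun n hn => hn.le
  have h2 : ∀ᶠ n : ℕ in atTop, C / (ε / 3) / √n < δ / 2 := by
    have : Tendsto (fun n : ℕ => C / (ε / 3) / √n) atTop (𝓝 0) :=
      tendsto_const_nhds.div_atTop (Real.tendsto_sqrt_atTop.comp tendsto_natCast_atTop_atTop)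
    exact this.eventually_lt_const (by positivity)
  obtain ⟨N₀, hN₀⟩ := eventually_atTop.1 h1
  -- N is fixed before p, so that Np can then be made less than δ/2.
  obtain ⟨N, hN, hNpos, hNδ⟩ :=
    ((eventually_ge_atTop N₀).and ((eventually_gt_atTop 0).and h2)).exists
  have hlim : ∀ (F : ℝ → ℝ), ContinuousAt F 0 → ∀ a, F 0 < a → ∀ᶠ p in 𝓝[>] (0 : ℝ), F p < a :=
    fun F hF a ha => (hF.tendsto.mono_left nhdsWithin_le_nhds).eventually_lt_const ha
  have hC' := hlim (fun p => p * C) (by fun_prop) (ε / 3) (by simpa using by positivity)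
  have hN' := hlim (fun p => N * p) (by fun_prop) (δ / 2) (by simpa using by positivity)
  have hρ' := hlim (fun p => √(betaSq m σ x₀) / (1 - p))
    (ContinuousAt.div (by fun_prop) (by fun_prop) (by norm_num)) ρ (by simpa using hβρ)
  have hp' := hlim id continuousAt_id (1 - betaSq m σ x₀) (by simpa using hβ)
  filter_upwards [hC', hN', hρ', hp', self_mem_nhdsWithin] with p hpC hpN hpρ hp1 hp0
  have hp : p ∈ Set.Ioo 0 (1 - betaSq m σ x₀) := ⟨hp0, hp1⟩
  have key := measure_cyclingEstimator_error_le (ε := ε / 3) (hX p hp) (hRmeas p hp)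
    (hRgeom p hp) (hindep p hp) hbdd hp0 (by have := hp.2; linarith) hpρ.le hρ1 (by positivity)
    hpC.le hNpos fun n hn => hN₀ n (hN.trans hn)
  rw [mul_div_cancel₀ ε (three_ne_zero)] at key
  refine key.trans (le_trans (ENNReal.ofReal_le_ofReal ?_) hδη)
  linarith
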